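/- Let $n\ge 2$ and let $W=(w_{ij})$ be an $n\times n$ matrix of edge weights with $w_{ij}\in(0,1)$ for $i\neq j$. Put $R_i=\sum_{j\ne i}\ln w_{ij}$ and $C_j=\sum_{i\ne j}\ln(1-w_{ij})$, and let $\psi=\Gamma'/\Gamma$ be the digamma function on $(0,\infty)$, with inverse $\psi^{-1}:\mathbb R\to(0,\infty)$. Suppose that $\hat\theta=(\hat a,\hat b)\in(0,\infty)^{2n}$ solves the maximum likelihood (ML) equations of the directed graph model with independent $\mathrm{Beta}(a_i,b_j)$-distributed weights $w_{ij}$ ($i\ne j$), that is, $$\sum_{j\ne i}\psi(a_i+b_j)-(n-1)\psi(a_i)+R_i=0\quad(i=1,\dots,n),\qquad \sum_{i\ne j}\psi(a_i+b_j)-(n-1)\psi(b_j)+C_j=0\quad(j=1,\dots,n).$$ Then $\hat\theta$ is the unique solution of the ML equations in $(0,\infty)^{2n}$. Let $f=(g,h):(0,\infty)^{2n}\to(0,\infty)^{2n}$ be given by $$g_i(a,b)=\psi^{-1}\Big[\tfrac1{n-1}\Big(R_i+\sum_{j\ne i}\psi(a_i+b_j)\Big)\Big],\qquad h_j(a,b)=\psi^{-1}\Big[\tfrac1{n-1}\Big(C_j+\sum_{i\ne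 j}\psi(a_i+b_j)\Big)\Big].$$ Then there is a closed neighbourhood $K\subset(0,\infty)^{2n}$ of $\hat\theta$ such that $f(K)\subseteq K$ and $f$ is a contraction on $K$ with respect to the $L_1$ norm (for some $q<1$, $\|f(\theta)-f(\theta')\|_1\le q\,\|\theta-\theta'\|_1$ for all $\theta,\theta'\in K$); the only fixed point of $f$ in $K$ is $\hat\theta$; and for every $\theta^{(0)}\in K$ the iteration $\theta^{(t)}=f(\theta^{(t-1)})$ converges to $\hat\theta$. -/

import Mathlib

open Set Filter Topology
open scoped NNReal

namespace BetaGraph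

noncomputable section

/-- The digamma function `ψ = Γ' / Γ`; only its values on `(0, ∞)` are used. -/
def digamma (x : ℝ) : ℝ := logDeriv Real.Gamma x

/-- The inverse `ψ⁻¹ : ℝ → (0, ∞)` of the bijection `ψ : (0, ∞) → ℝ`. -/
def digammaInv (y : ℝ) : ℝ := Function.invFunOn digamma (Ioi 0) y

/-- The space `ℝ²ⁿ` of parameters `θ = (a, b)`, with the `L₁` norm. -/
abbrev Param (n : ℕ) : Type := PiLp 1 (fun _ : Fin n ⊕ Fin n => ℝ)

/-- The coordinates `a₁, …, aₙ` of `θ = (a, b)`. -/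
def Param.a {n : ℕ} (θ : Param n) (i : Fin n) : ℝ := θ (Sum.inl i)

/-- The coordinates `b₁, …, bₙ` of `θ = (a, b)`. -/
def Param.b {n : ℕ} (θ : Param n) (j : Fin n) : ℝ := θ (Sum.inr j)

/-- The model's parameter space: all `a i` and all `b j` are positive. -/
def positiveParams (n : ℕ) : Set (Param n) :=
  {θ | (∀ i, 0 < θ.a i) ∧ ∀ j, 0 < θ.b j}

/-- The statistic `R i = ∑_{j ≠ i} ln w_{ij}` of an edge-weight matrix. -/
def rowStat {n : ℕ} (W : Matrix (Fin n) (Fin n) ℝ) (i : Fin n) : ℝ :=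
  ∑ j ∈ Finset.univ.erase i, Real.log (W i j)

/-- The statistic `C j = ∑_{i ≠ j} ln (1 - w_{ij})` of an edge-weight matrix. -/
def colStat {n : ℕ} (W : Matrix (Fin n) (Fin n) ℝ) (j : Fin n) : ℝ :=
  ∑ i ∈ Finset.univ.erase j, Real.log (1 - W i j)

/-- `θ = (a, b)` is a point of the parameter space that solves the system of maximum likelihood
equations with data `R`, `C`. -/
def IsMLSolution {n : ℕ} (R C : Fin n → ℝ) (θ : Param n) : Prop :=
  θ ∈ positiveParams n ∧
  (∀ i, ∑ j ∈ Finset.univ.erase i, digamma (θ.a i + θ.b j)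
      - ((n : ℝ) - 1) * digamma (θ.a i) + R i = 0) ∧
  (∀ j, ∑ i ∈ Finset.univ.erase j, digamma (θ.a i + θ.b j)
      - ((n : ℝ) - 1) * digamma (θ.b j) + C j = 0)

/-- `g i (a, b) = ψ⁻¹ [(R i + ∑_{j ≠ i} ψ (a i + b j)) / (n - 1)]`. -/
def gMap {n : ℕ} (R : Fin n → ℝ) (θ : Param n) (i : Fin n) : ℝ :=
  digammaInv (1 / ((n : ℝ) - 1) * R i
    + 1 / ((n : ℝ) - 1) * ∑ j ∈ Finset.univ.erase i, digamma (θ.a i + θ.b j))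

/-- `h j (a, b) = ψ⁻¹ [(C j + ∑_{i ≠ j} ψ (a i + b j)) / (n - 1)]`. -/
def hMap {n : ℕ} (C : Fin n → ℝ) (θ : Param n) (j : Fin n) : ℝ :=
  digammaInv (1 / ((n : ℝ) - 1) * C j
    + 1 / ((n : ℝ) - 1) * ∑ i ∈ Finset.univ.erase j, digamma (θ.a i + θ.b j))

/-- The map `f = (g, h)`. -/
def fMap {n : ℕ} (R C : Fin n → ℝ) (θ : Param n) : Param n :=
  WithLp.toLp 1 (Sum.elim (gMap R θ) (hMap C θ))

end

end BetaGraph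

/-!
The whole argument rests on one inequality for the trigamma function,
`ψ' (a + b) * (1 / ψ' a + 1 / ψ' b) < 1` (`trigamma_add_mul_lt_one`): the reciprocal of `ψ'` is
strictly superadditive. It follows from `x * ψ' x` being strictly decreasing (`mul_trigamma_lt`),
which is read off from the series `ψ' x = ∑ 1 / (x + k) ^ 2` by comparing both `ψ' y` and
`ψ' x - ψ' y` with telescoping series. The series itself comes from the recurrence
`ψ (x + 1) = ψ x + 1 / x` and the log-convexity of `Γ`.

*Uniqueness.* The inequality says, via Cauchy–Schwarz, that the Hessian of `-log B(a, b)` is negative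
definite. So the log-likelihood, a sum of such terms over the edges plus a linear function, has a
strictly decreasing gradient, and the gradient has at most one zero (`IsMLSolution.unique`).

*Contraction.* At a solution `θ` the map `f` has a fixed point, and there the `L₁` operator norm of
its derivative, the largest absolute column sum, is at most the maximum of
`ψ' (a i + b j) * (1 / ψ' (a i) + 1 / ψ' (b j))` over all `i` and `j`, hence below `1`
(`norm_fDeriv_lt_one`). Since `f` is strictly differentiable at `θ`, it contracts a small closed
`L₁` ball around `θ` into itself.
-/

namespace BetaGraph

/-! ### The digamma and trigamma functions -/

/-- The trigamma function on `(0, ∞)`, given by its series; `hasDerivAt_digamma` identifies it with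
the derivative of `digamma`. -/
noncomputable def trigamma (x : ℝ) : ℝ := ∑' k : ℕ, 1 / (x + k) ^ 2

theorem hasSum_sub_succ_of_tendsto_zero {u : ℕ → ℝ} (hu : ∀ k, u (k + 1) ≤ u k)
    (h0 : Tendsto u atTop (𝓝 0)) : HasSum (fun k => u k - u (k + 1)) (u 0) := by
  rw [hasSum_iff_tendsto_nat_of_nonneg fun k => sub_nonneg.2 (hu k)]
  simp_rw [Finset.sum_range_sub']
  simpa using h0.const_sub (u 0)

theorem summable_trigamma {x : ℝ} (hx : 0 < x) : Summable fun k : ℕ => 1 / (x + k) ^ 2 := by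
  refine ((Real.summable_one_div_nat_add_rpow x 2).2 (by norm_num)).congr fun k => ?_
  rw [abs_of_pos (by positivity), add_comm]
  norm_cast

theorem trigamma_pos {x : ℝ} (hx : 0 < x) : 0 < trigamma x :=
  (summable_trigamma hx).tsum_pos (fun k => by positivity) 0 (by positivity)

theorem digamma_add_one {x : ℝ} (hx : 0 < x) : digamma (x + 1) = digamma x + 1 / x := by
  have hG : ∀ {y : ℝ}, 0 < y → DifferentiableAt ℝ Real.Gamma y := fun hy =>
    Real.differentiableAt_Gamma fun m => by
      have : (0 : ℝ) ≤ m := m.cast_nonneg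
      linarith
  have h1 : HasDerivAt (fun y : ℝ => Real.Gamma (y + 1)) (deriv Real.Gamma (x + 1)) x :=
    (hG (by linarith : 0 < x + 1)).hasDerivAt.comp_add_const x 1
  have h2 : HasDerivAt (fun y : ℝ => y * Real.Gamma y)
      (1 * Real.Gamma x + x * deriv Real.Gamma x) x :=
    (hasDerivAt_id x).mul (hG hx).hasDerivAt
  have h3 : (fun y : ℝ => Real.Gamma (y + 1)) =ᶠ[𝓝 x] fun y => y * Real.Gamma y := by
    filter_upwards [lt_mem_nhds hx] with y hy using Real.Gamma_add_one hy.ne'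
  have h4 := (h1.congr_of_eventuallyEq h3.symm).unique h2
  have hΓ := (Real.Gamma_pos_of_pos hx).ne'
  rw [digamma, digamma, logDeriv_apply, logDeriv_apply, h4, Real.Gamma_add_one hx.ne']
  field_simp
  ring

theorem digamma_add_nat {x : ℝ} (hx : 0 < x) (N : ℕ) :
    digamma (x + N) = digamma x + ∑ k ∈ Finset.range N, 1 / (x + k) := by
  induction N with
  | zero => simp
  | succ N ih =>
    rw [Finset.sum_range_succ, Nat.cast_succ, ← add_assoc, digamma_add_one (by positivity), ih]
    ring

/-- Log-convexity of `Γ`, read off on its logarithmic derivative. -/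
theorem monotoneOn_digamma : MonotoneOn digamma (Ioi 0) := by
  have hd : ∀ x ∈ Ioi (0 : ℝ), DifferentiableAt ℝ Real.Gamma x := fun x hx =>
    (Real.differentiableOn_Gamma_Ioi x hx).differentiableAt (Ioi_mem_nhds hx)
  have h := Real.convexOn_log_Gamma.monotoneOn_deriv fun x hx =>
    (hd x hx).log (Real.Gamma_pos_of_pos hx).ne'
  refine h.congr fun x hx => ?_
  exact deriv.log (hd x hx) (Real.Gamma_pos_of_pos hx).ne'

/-- Monotonicity squeezes `ψ (x + N) - ψ (1 + N)` between quantities that the recurrence turns into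
a fixed number of terms of size `O (1 / N)`. -/
theorem tendsto_digamma_add_nat_sub {x : ℝ} (hx : 0 < x) :
    Tendsto (fun N : ℕ => digamma (x + N) - digamma (1 + N)) atTop (𝓝 0) := by
  obtain ⟨m, hm⟩ := exists_nat_ge x
  have hinv : ∀ k : ℕ, Tendsto (fun N : ℕ => 1 / ((N : ℝ) + k)) atTop (𝓝 0) := fun k => by
    simp_rw [one_div]
    exact tendsto_inv_atTop_zero.comp
      (tendsto_atTop_add_const_right _ _ tendsto_natCast_atTop_atTop)
  have hup : Tendsto (fun N : ℕ => ∑ k ∈ Finset.range m, 1 / ((N : ℝ) + k)) atTop (𝓝 0) := by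
    simpa using tendsto_finsetSum (Finset.range m) fun k _ => hinv k
  have hlo : Tendsto (fun N : ℕ => -(1 / ((N : ℝ) + (0 : ℕ)))) atTop (𝓝 0) := by
    simpa using (hinv 0).neg
  have hmono := monotoneOn_digamma
  refine tendsto_of_tendsto_of_tendsto_of_le_of_le' hlo hup ?_ ?_
  · filter_upwards [eventually_gt_atTop 0] with N hN
    have hN' : (0 : ℝ) < N := by exact_mod_cast hN
    have h1 := digamma_add_one hN'
    have h2 : digamma N ≤ digamma (x + N) :=
      hmono hN' (by simp only [mem_Ioi]; positivity) (by linarith)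
    rw [add_comm (1 : ℝ), h1]
    simp only [CharP.cast_eq_zero, add_zero]
    linarith
  · filter_upwards [eventually_gt_atTop 0] with N hN
    have hN' : (0 : ℝ) < N := by exact_mod_cast hN
    have h1 := digamma_add_nat hN' m
    have h2 : digamma (x + N) ≤ digamma (N + m) :=
      hmono (by simp only [mem_Ioi]; positivity) (by simp only [mem_Ioi]; positivity) (by linarith)
    have h3 : digamma N ≤ digamma (1 + N) :=
      hmono hN' (by simp only [mem_Ioi]; positivity) (by linarith)
    linarith

theorem hasDerivAt_digammaSeries_term (k : ℕ) {y : ℝ} (hy : 0 < y) :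
    HasDerivAt (fun x : ℝ => 1 / (1 + (k : ℝ)) - 1 / (x + k)) (1 / (y + k) ^ 2) y := by
  have h := (((hasDerivAt_id y).add_const (k : ℝ)).inv
    (by simp only [id]; positivity)).const_sub (1 / (1 + (k : ℝ)))
  simp only [id, one_div, neg_div, neg_neg] at h ⊢
  exact h

theorem norm_trigamma_term_le {c x : ℝ} (hc : 0 < c) (hx : c ≤ x) (k : ℕ) :
    ‖1 / (x + k) ^ 2‖ ≤ 1 / (c + k) ^ 2 := by
  rw [Real.norm_of_nonneg (by positivity)]
  gcongr

theorem hasSum_digamma {x : ℝ} (hx : 0 < x) :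
    HasSum (fun k : ℕ => 1 / (1 + (k : ℝ)) - 1 / (x + k)) (digamma x - digamma 1) := by
  obtain ⟨c, hc, hcx⟩ := exists_between (lt_min hx one_pos)
  have hs : Summable fun k : ℕ => 1 / (1 + (k : ℝ)) - 1 / (x + k) :=
    summable_of_summable_hasDerivAt_of_isPreconnected (summable_trigamma hc) isOpen_Ioi
      isPreconnected_Ioi (fun k y hy => hasDerivAt_digammaSeries_term k (hc.trans hy))
      (fun k y hy => norm_trigamma_term_le hc (le_of_lt hy) k)
      (y₀ := 1) (hcx.trans_le (min_le_right _ _)) (by simp)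
      (hcx.trans_le (min_le_left _ _))
  have h1 : Tendsto (fun N : ℕ => ∑ k ∈ Finset.range N, (1 / (1 + (k : ℝ)) - 1 / (x + k))) atTop
      (𝓝 (digamma x - digamma 1)) := by
    have h := (tendsto_digamma_add_nat_sub hx).const_sub (digamma x - digamma 1)
    rw [sub_zero] at h
    refine h.congr fun N => ?_
    rw [Finset.sum_sub_distrib, digamma_add_nat hx, digamma_add_nat one_pos]
    ring
  rw [← tendsto_nhds_unique hs.hasSum.tendsto_sum_nat h1]
  exact hs.hasSum

theorem hasDerivAt_digamma {x : ℝ} (hx : 0 < x) : HasDerivAt digamma (trigamma x) x := by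
  obtain ⟨c, hc, hcx⟩ := exists_between hx
  have h := hasDerivAt_tsum_of_isPreconnected (summable_trigamma hc) isOpen_Ioi
    isPreconnected_Ioi (fun k y hy => hasDerivAt_digammaSeries_term k (hc.trans hy))
    (fun k y hy => norm_trigamma_term_le hc (le_of_lt hy) k) hcx (hasSum_digamma hx).summable hcx
  refine (h.add_const (digamma 1)).congr_of_eventuallyEq ?_
  filter_upwards [lt_mem_nhds hx] with y hy
  rw [(hasSum_digamma hy).tsum_eq]
  ring

theorem continuousAt_trigamma {x : ℝ} (hx : 0 < x) : ContinuousAt trigamma x := by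
  obtain ⟨c, hc, hcx⟩ := exists_between hx
  have h : ContinuousOn trigamma (Ici c) := by
    refine continuousOn_tsum (fun k => ?_) (summable_trigamma hc)
      fun k y hy => norm_trigamma_term_le hc hy k
    refine continuousOn_const.div (by fun_prop) fun y hy => ?_
    have : 0 < y := hc.trans_le hy
    positivity
  exact h.continuousAt (Ici_mem_nhds hcx)

theorem hasStrictDerivAt_digamma {x : ℝ} (hx : 0 < x) :
    HasStrictDerivAt digamma (trigamma x) x :=
  hasStrictDerivAt_of_hasDerivAt_of_continuousAt
    ((lt_mem_nhds hx).mono fun _ hy => hasDerivAt_digamma hy) (continuousAt_trigamma hx)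

theorem strictMonoOn_digamma : StrictMonoOn digamma (Ioi 0) := by
  refine strictMonoOn_of_deriv_pos (convex_Ioi 0)
    (fun x hx => (hasDerivAt_digamma hx).continuousAt.continuousWithinAt) fun x hx => ?_
  rw [interior_Ioi] at hx
  rw [(hasDerivAt_digamma hx).deriv]
  exact trigamma_pos hx

/-- Injectivity of `ψ` on `(0, ∞)` suffices: the junk value of `digammaInv` outside the range of `ψ`
plays no role here. -/
theorem digammaInv_digamma {x : ℝ} (hx : 0 < x) : digammaInv (digamma x) = x :=
  strictMonoOn_digamma.injOn.leftInvOn_invFunOn hx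

theorem hasStrictDerivAt_digammaInv {x : ℝ} (hx : 0 < x) :
    HasStrictDerivAt digammaInv (trigamma x)⁻¹ (digamma x) :=
  (hasStrictDerivAt_digamma hx).to_local_left_inverse (trigamma_pos hx).ne'
    ((lt_mem_nhds hx).mono fun _ hy => digammaInv_digamma hy)

/-! ### Superadditivity of the reciprocal of the trigamma function -/

/-- Comparison with the telescoping series of `1 / y + 1 / y ^ 2`. -/
theorem trigamma_le {y : ℝ} (hy : 0 < y) : trigamma y ≤ 1 / y + 1 / y ^ 2 := by
  have key : ∀ Y : ℝ, 0 < Y →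
      1 / Y ^ 2 ≤ (1 / Y + 1 / Y ^ 2) - (1 / (Y + 1) + 1 / (Y + 1) ^ 2) := fun Y hY => by
    rw [← sub_nonneg]
    have : (1 / Y + 1 / Y ^ 2) - (1 / (Y + 1) + 1 / (Y + 1) ^ 2) - 1 / Y ^ 2
        = 1 / (Y * (Y + 1) ^ 2) := by
      field_simp
      ring
    rw [this]
    positivity
  have hlim : Tendsto (fun k : ℕ => 1 / (y + k) + 1 / (y + k) ^ 2) atTop (𝓝 0) := by
    have h : Tendsto (fun k : ℕ => (y + (k : ℝ))⁻¹) atTop (𝓝 0) :=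
      tendsto_inv_atTop_zero.comp (tendsto_atTop_add_const_left _ _ tendsto_natCast_atTop_atTop)
    simpa using h.add (h.pow 2)
  have hkey : ∀ k : ℕ, 1 / (y + k) ^ 2 ≤ (1 / (y + k) + 1 / (y + k) ^ 2)
      - (1 / (y + (k + 1 : ℕ)) + 1 / (y + (k + 1 : ℕ)) ^ 2) := fun k => by
    have := key (y + k) (by positivity)
    push_cast
    rwa [← add_assoc]
  have hsum := hasSum_sub_succ_of_tendsto_zero
    (fun k => by
      have h0 : (0 : ℝ) ≤ 1 / (y + k) ^ 2 := by positivity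
      exact sub_nonneg.1 (h0.trans (hkey k))) hlim
  have := hasSum_le hkey (summable_trigamma hy).hasSum hsum
  simpa [trigamma] using this

/-- Comparison with the telescoping series of `1 / x * (1 / y + 1 / y ^ 2)`, whose terms are chosen
so that the sum matches the upper bound of `trigamma_le`. -/
theorem lt_trigamma_sub_trigamma {x y : ℝ} (hx : 0 < x) (hxy : x < y) :
    (y - x) * (1 / x * (1 / y + 1 / y ^ 2)) < trigamma x - trigamma y := by
  have hy := hx.trans hxy
  have key : ∀ X Y : ℝ, 0 < X → X < Y →
      (Y - X) * (1 / X * (1 / Y + 1 / Y ^ 2)) -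
        (Y - X) * (1 / (X + 1) * (1 / (Y + 1) + 1 / (Y + 1) ^ 2)) < 1 / X ^ 2 - 1 / Y ^ 2 := by
    intro X Y hX hXY
    have hY := hX.trans hXY
    rw [← sub_pos]
    have : 1 / X ^ 2 - 1 / Y ^ 2 - ((Y - X) * (1 / X * (1 / Y + 1 / Y ^ 2)) -
        (Y - X) * (1 / (X + 1) * (1 / (Y + 1) + 1 / (Y + 1) ^ 2)))
        = (Y - X) * ((Y + 1) ^ 2 - X ^ 2) / (X ^ 2 * Y * (X + 1) * (Y + 1) ^ 2) := by
      field_simp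
      ring
    rw [this]
    have h1 : 0 < Y - X := by linarith
    have h2 : 0 < (Y + 1) ^ 2 - X ^ 2 := by nlinarith
    positivity
  have hlim : Tendsto (fun k : ℕ => (y - x) * (1 / (x + k) * (1 / (y + k) + 1 / (y + k) ^ 2)))
      atTop (𝓝 0) := by
    have h : ∀ z : ℝ, Tendsto (fun k : ℕ => (z + (k : ℝ))⁻¹) atTop (𝓝 0) := fun z =>
      tendsto_inv_atTop_zero.comp (tendsto_atTop_add_const_left _ _ tendsto_natCast_atTop_atTop)
    simpa using ((h x).mul ((h y).add ((h y).pow 2))).const_mul (y - x)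
  have hkey : ∀ k : ℕ, (y - x) * (1 / (x + k) * (1 / (y + k) + 1 / (y + k) ^ 2))
      - (y - x) * (1 / (x + (k + 1 : ℕ)) * (1 / (y + (k + 1 : ℕ)) + 1 / (y + (k + 1 : ℕ)) ^ 2))
      < 1 / (x + k) ^ 2 - 1 / (y + k) ^ 2 := fun k => by
    have := key (x + k) (y + k) (by positivity) (by linarith)
    push_cast
    rw [← add_assoc, ← add_assoc]
    simpa using this
  have hsum := hasSum_sub_succ_of_tendsto_zero
    (fun k => by
      have h0 : 0 ≤ y - x := by linarith
      push_cast
      gcongr <;> linarith) hlim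
  have := hasSum_lt (fun k => (hkey k).le) (hkey 0) hsum
    ((summable_trigamma hx).hasSum.sub (summable_trigamma hy).hasSum)
  simpa [trigamma] using this

theorem mul_trigamma_lt {x y : ℝ} (hx : 0 < x) (hxy : x < y) :
    y * trigamma y < x * trigamma x := by
  have hy := hx.trans hxy
  have h1 := mul_lt_mul_of_pos_left (lt_trigamma_sub_trigamma hx hxy) hx
  have h2 := mul_le_mul_of_nonneg_left (trigamma_le hy) (sub_nonneg.2 hxy.le)
  have h3 : x * ((y - x) * (1 / x * (1 / y + 1 / y ^ 2))) = (y - x) * (1 / y + 1 / y ^ 2) := by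
    field_simp
  rw [h3] at h1
  linarith

/-- Strict superadditivity of `1 / ψ'`: since `x * ψ' x` decreases, the two summands are below
`a / (a + b)` and `b / (a + b)`. -/
theorem trigamma_add_mul_lt_one {a b : ℝ} (ha : 0 < a) (hb : 0 < b) :
    trigamma (a + b) * ((trigamma a)⁻¹ + (trigamma b)⁻¹) < 1 := by
  have key : ∀ {x y : ℝ}, 0 < x → x < y → trigamma y * (trigamma x)⁻¹ < x / y := fun hx hxy => by
    rw [← div_eq_mul_inv, div_lt_div_iff₀ (trigamma_pos hx) (hx.trans hxy), mul_comm]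
    exact mul_trigamma_lt hx hxy
  have h1 := key ha (by linarith : a < a + b)
  have h2 := key hb (by linarith : b < a + b)
  have h3 : a / (a + b) + b / (a + b) = 1 := by rw [← add_div, div_self (by positivity)]
  rw [mul_add]
  linarith

/-! ### Uniqueness of the solution -/

/-- The quadratic form of the Hessian of `-log B` at `(a, b)` is negative definite: maximize over
`u + v` by Cauchy–Schwarz and apply superadditivity. -/
theorem trigamma_quadraticForm_neg {a b u v : ℝ} (ha : 0 < a) (hb : 0 < b) (huv : u ≠ 0 ∨ v ≠ 0) :
    (u + v) ^ 2 * trigamma (a + b) - u ^ 2 * trigamma a - v ^ 2 * trigamma b < 0 := by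
  have hA := trigamma_pos ha
  have hB := trigamma_pos hb
  have hS := trigamma_pos (add_pos ha hb)
  have h := trigamma_add_mul_lt_one ha hb
  set A := trigamma a
  set B := trigamma b
  set S := trigamma (a + b)
  have hQ : 0 < u ^ 2 * A + v ^ 2 * B := by
    rcases huv with h | h
    · have := mul_pos (pow_pos (abs_pos.2 h) 2) hA
      rw [sq_abs] at this
      have := mul_nonneg (sq_nonneg v) hB.le
      linarith
    · have := mul_pos (pow_pos (abs_pos.2 h) 2) hB
      rw [sq_abs] at this
      have := mul_nonneg (sq_nonneg u) hA.le
      linarith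
  have hCS : (u + v) ^ 2 ≤ (u ^ 2 * A + v ^ 2 * B) * (A⁻¹ + B⁻¹) := by
    rw [← sub_nonneg]
    have : (u ^ 2 * A + v ^ 2 * B) * (A⁻¹ + B⁻¹) - (u + v) ^ 2
        = (u * A - v * B) ^ 2 / (A * B) := by
      field_simp
      ring
    rw [this]
    positivity
  have h1 := mul_le_mul_of_nonneg_right hCS hS.le
  have h2 := mul_lt_mul_of_pos_left h hQ
  nlinarith

/-- The gradient of `-log B` is strictly monotone decreasing: differentiate along the segment
between the two points. -/
theorem digamma_pairing_neg {a b a' b' : ℝ} (ha : 0 < a) (hb : 0 < b) (ha' : 0 < a')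
    (hb' : 0 < b') (hne : a - a' ≠ 0 ∨ b - b' ≠ 0) :
    ((a - a') + (b - b')) * (digamma (a + b) - digamma (a' + b'))
      - (a - a') * (digamma a - digamma a') - (b - b') * (digamma b - digamma b') < 0 := by
  set u := a - a' with hu
  set v := b - b' with hv
  have hpos : ∀ {x d t : ℝ}, 0 < x → 0 < x + d → t ∈ Icc (0 : ℝ) 1 → 0 < x + t * d := by
    intro x d t hx hxd ht
    rcases eq_or_lt_of_le ht.1 with h | h
    · rw [← h]; simpa using hx
    · nlinarith [ht.2, mul_pos h hxd, mul_nonneg (sub_nonneg.2 ht.2) hx.le]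
  let φ : ℝ → ℝ := fun t => (u + v) * digamma ((a' + b') + t * (u + v))
    - u * digamma (a' + t * u) - v * digamma (b' + t * v)
  have hline : ∀ {x d t : ℝ}, 0 < x + t * d →
      HasDerivAt (fun s => d * digamma (x + s * d)) (d * (trigamma (x + t * d) * d)) t := by
    intro x d t hp
    have h1 : HasDerivAt (fun s : ℝ => x + s * d) d t := by
      simpa using ((hasDerivAt_id t).mul_const d).const_add x
    exact ((hasDerivAt_digamma hp).comp t h1).const_mul d
  have hpa : ∀ t ∈ Icc (0 : ℝ) 1, 0 < a' + t * u := fun t ht =>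
    hpos ha' (by rw [hu]; linarith) ht
  have hpb : ∀ t ∈ Icc (0 : ℝ) 1, 0 < b' + t * v := fun t ht =>
    hpos hb' (by rw [hv]; linarith) ht
  have hpab : ∀ t ∈ Icc (0 : ℝ) 1, 0 < (a' + b') + t * (u + v) := fun t ht => by
    have := hpa t ht
    have := hpb t ht
    linarith
  have hφ : ∀ t ∈ Icc (0 : ℝ) 1, HasDerivAt φ
      ((u + v) * (trigamma ((a' + b') + t * (u + v)) * (u + v))
        - u * (trigamma (a' + t * u) * u) - v * (trigamma (b' + t * v) * v)) t := fun t ht =>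
    ((hline (hpab t ht)).sub (hline (hpa t ht))).sub (hline (hpb t ht))
  have hanti : StrictAntiOn φ (Icc 0 1) := by
    refine strictAntiOn_of_deriv_neg (convex_Icc 0 1)
      (fun t ht => (hφ t ht).continuousAt.continuousWithinAt) fun t ht => ?_
    have ht' := interior_subset ht
    rw [(hφ t ht').deriv]
    have h := trigamma_quadraticForm_neg (hpa t ht') (hpb t ht') hne
    have e : (a' + b') + t * (u + v) = (a' + t * u) + (b' + t * v) := by ring
    rw [e]
    linarith
  have h := hanti (by simp : (0 : ℝ) ∈ Icc (0 : ℝ) 1) (by simp : (1 : ℝ) ∈ Icc (0 : ℝ) 1) one_pos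
  simp only [φ, zero_mul, one_mul, add_zero] at h
  rw [show a' + b' + (u + v) = a + b by rw [hu, hv]; ring, show a' + u = a by rw [hu]; ring,
    show b' + v = b by rw [hv]; ring] at h
  linarith

theorem cast_card_erase {n : ℕ} (i : Fin n) :
    ((Finset.univ.erase i).card : ℝ) = (n : ℝ) - 1 := by
  rw [Finset.card_erase_of_mem (Finset.mem_univ i), Finset.card_univ, Fintype.card_fin,
    Nat.cast_sub (Nat.one_le_of_lt i.pos), Nat.cast_one]

theorem sum_erase_comm {n : ℕ} (F : Fin n → Fin n → ℝ) :
    ∑ i, ∑ j ∈ Finset.univ.erase i, F i j = ∑ j, ∑ i ∈ Finset.univ.erase j, F i j :=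
  Finset.sum_comm' fun i j => by simp [eq_comm]

/-- The likelihood equations say that the gradient of the log-likelihood vanishes. Paired with
`θ - θ'`, the difference of the gradients splits into nonpositive contributions of the edges, so each
of them vanishes; as `2 ≤ n`, every coordinate belongs to an edge. -/
theorem IsMLSolution.unique {n : ℕ} (hn : 2 ≤ n) {R C : Fin n → ℝ} {θ θ' : Param n}
    (h : IsMLSolution R C θ) (h' : IsMLSolution R C θ') : θ = θ' := by
  obtain ⟨⟨ha, hb⟩, hr, hc⟩ := h
  obtain ⟨⟨ha', hb'⟩, hr', hc'⟩ := h'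
  -- The contribution of the edge `(i, j)` to the pairing of `θ - θ'` with the difference of the
  -- two log-likelihood gradients.
  let E : Fin n → Fin n → ℝ := fun i j =>
    ((θ.a i - θ'.a i) + (θ.b j - θ'.b j)) *
        (digamma (θ.a i + θ.b j) - digamma (θ'.a i + θ'.b j))
      - (θ.a i - θ'.a i) * (digamma (θ.a i) - digamma (θ'.a i))
      - (θ.b j - θ'.b j) * (digamma (θ.b j) - digamma (θ'.b j))
  have hneg : ∀ i j, θ.a i - θ'.a i ≠ 0 ∨ θ.b j - θ'.b j ≠ 0 → E i j < 0 := fun i j hne =>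
    digamma_pairing_neg (ha i) (hb j) (ha' i) (hb' j) hne
  have hE : ∀ i j, E i j ≤ 0 := fun i j => by
    by_cases hne : θ.a i - θ'.a i ≠ 0 ∨ θ.b j - θ'.b j ≠ 0
    · exact (hneg i j hne).le
    · push Not at hne
      simp [E, hne.1, hne.2]
  let F : Fin n → Fin n → ℝ := fun i j => (θ.a i - θ'.a i) *
    ((digamma (θ.a i + θ.b j) - digamma (θ'.a i + θ'.b j))
      - (digamma (θ.a i) - digamma (θ'.a i)))
  let G : Fin n → Fin n → ℝ := fun i j => (θ.b j - θ'.b j) *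
    ((digamma (θ.a i + θ.b j) - digamma (θ'.a i + θ'.b j))
      - (digamma (θ.b j) - digamma (θ'.b j)))
  have e : ∀ S S' A A' m r : ℝ, S - m * A + r = 0 → S' - m * A' + r = 0 →
      S - S' - (m * A - m * A') = 0 := fun S S' A A' m r h1 h2 => by linarith
  have hF : ∀ i, ∑ j ∈ Finset.univ.erase i, F i j = 0 := fun i => by
    simp only [F, ← Finset.mul_sum, Finset.sum_sub_distrib, Finset.sum_const, nsmul_eq_mul,
      cast_card_erase]
    rw [e _ _ _ _ _ _ (hr i) (hr' i), mul_zero]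
  have hG : ∀ j, ∑ i ∈ Finset.univ.erase j, G i j = 0 := fun j => by
    simp only [G, ← Finset.mul_sum, Finset.sum_sub_distrib, Finset.sum_const, nsmul_eq_mul,
      cast_card_erase]
    rw [e _ _ _ _ _ _ (hc j) (hc' j), mul_zero]
  have hEFG : ∀ i j, E i j = F i j + G i j := fun i j => by
    simp only [E, F, G]
    ring
  have hsum : ∑ i, ∑ j ∈ Finset.univ.erase i, E i j = 0 := by
    simp only [hEFG, Finset.sum_add_distrib, hF, zero_add]
    rw [sum_erase_comm]
    simp only [hG, Finset.sum_const_zero]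
  have hzero : ∀ i j, j ≠ i → E i j = 0 := fun i j hij => by
    have h1 := (Finset.sum_eq_zero_iff_of_nonpos fun i _ =>
      Finset.sum_nonpos fun j _ => hE i j).1 hsum i (Finset.mem_univ i)
    exact (Finset.sum_eq_zero_iff_of_nonpos fun j _ => hE i j).1 h1 j (by simpa using hij)
  have hcoord : ∀ i j, j ≠ i → θ.a i = θ'.a i ∧ θ.b j = θ'.b j := fun i j hij => by
    by_contra hcon
    refine (hneg i j ?_).ne (hzero i j hij)
    rw [sub_ne_zero, sub_ne_zero]
    tauto
  have hex : ∀ i : Fin n, ∃ j, j ≠ i := fun i =>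
    have : Nontrivial (Fin n) := Fin.nontrivial_iff_two_le.2 hn
    exists_ne i
  ext (i | j)
  · obtain ⟨j, hj⟩ := hex i
    exact (hcoord i j hj).1
  · obtain ⟨i, hi⟩ := hex j
    exact (hcoord i j hi.symm).2

/-! ### The derivative of the iteration map -/

theorem cast_sub_one_pos {n : ℕ} (hn : 2 ≤ n) : 0 < (n : ℝ) - 1 := by
  have : (2 : ℝ) ≤ n := by exact_mod_cast hn
  linarith

/-- An ML equation, solved for the digamma value `A` of a single coordinate. -/
theorem eq_of_mlEquation {n : ℕ} (hn : 2 ≤ n) {r S A : ℝ}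
    (h : S - ((n : ℝ) - 1) * A + r = 0) :
    1 / ((n : ℝ) - 1) * r + 1 / ((n : ℝ) - 1) * S = A := by
  have := (cast_sub_one_pos hn).ne'
  field_simp
  linarith

theorem fMap_eq_self {n : ℕ} (hn : 2 ≤ n) {R C : Fin n → ℝ} {θ : Param n}
    (h : IsMLSolution R C θ) : fMap R C θ = θ := by
  obtain ⟨⟨ha, hb⟩, hr, hc⟩ := h
  ext (i | j)
  · change digammaInv _ = θ.a i
    rw [eq_of_mlEquation hn (hr i), digammaInv_digamma (ha i)]
  · change digammaInv _ = θ.b j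
    rw [eq_of_mlEquation hn (hc j), digammaInv_digamma (hb j)]

/-- The derivative of `θ ↦ a i + b j`. -/
noncomputable def edgeSum {n : ℕ} (i j : Fin n) : Param n →L[ℝ] ℝ :=
  PiLp.proj (𝕜 := ℝ) 1 (fun _ : Fin n ⊕ Fin n => ℝ) (Sum.inl i) +
    PiLp.proj (𝕜 := ℝ) 1 (fun _ : Fin n ⊕ Fin n => ℝ) (Sum.inr j)

/-- The derivative of `fMap` at a fixed point `θ`, where the factor `1 / ψ' (g i θ)` of the chain rule
is `1 / ψ' (a i)`. Its value at other points has no meaning. -/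
noncomputable def fDeriv {n : ℕ} (θ : Param n) : Param n →L[ℝ] Param n :=
  (PiLp.continuousLinearEquiv 1 ℝ (fun _ : Fin n ⊕ Fin n => ℝ)).symm.toContinuousLinearMap ∘L
    ContinuousLinearMap.pi (Sum.elim
      (fun i => (trigamma (θ.a i))⁻¹ • ((1 / ((n : ℝ) - 1)) •
        ∑ j ∈ Finset.univ.erase i, trigamma (θ.a i + θ.b j) • edgeSum i j))
      (fun j => (trigamma (θ.b j))⁻¹ • ((1 / ((n : ℝ) - 1)) •
        ∑ i ∈ Finset.univ.erase j, trigamma (θ.a i + θ.b j) • edgeSum i j)))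

theorem hasStrictFDerivAt_digamma_edge {n : ℕ} {θ : Param n} (hθ : θ ∈ positiveParams n)
    (i j : Fin n) : HasStrictFDerivAt (fun η : Param n => digamma (η.a i + η.b j))
      (trigamma (θ.a i + θ.b j) • edgeSum i j) θ :=
  HasStrictDerivAt.comp_hasStrictFDerivAt θ
    (hasStrictDerivAt_digamma (add_pos (hθ.1 i) (hθ.2 j))) (edgeSum i j).hasStrictFDerivAt

theorem hasStrictFDerivAt_fMap {n : ℕ} (hn : 2 ≤ n) {R C : Fin n → ℝ} {θ : Param n}
    (h : IsMLSolution R C θ) : HasStrictFDerivAt (fMap R C) (fDeriv θ) θ := by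
  have hpos := h.1
  rw [hasStrictFDerivAt_piLp]
  rintro (i | j)
  · have h1 := hasStrictDerivAt_digammaInv (hpos.1 i)
    rw [← eq_of_mlEquation hn (h.2.1 i)] at h1
    exact h1.comp_hasStrictFDerivAt θ (((HasStrictFDerivAt.fun_sum fun j _ =>
      hasStrictFDerivAt_digamma_edge hpos i j).const_mul (1 / ((n : ℝ) - 1))).const_add _)
  · have h1 := hasStrictDerivAt_digammaInv (hpos.2 j)
    rw [← eq_of_mlEquation hn (h.2.2 j)] at h1
    exact h1.comp_hasStrictFDerivAt θ (((HasStrictFDerivAt.fun_sum fun i _ =>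
      hasStrictFDerivAt_digamma_edge hpos i j).const_mul (1 / ((n : ℝ) - 1))).const_add _)

theorem norm_param {n : ℕ} (v : Param n) : ‖v‖ = ∑ i, |v.a i| + ∑ j, |v.b j| := by
  rw [PiLp.norm_eq_of_L1, Fintype.sum_sum_type]
  rfl

theorem sum_edges_eq_norm {n : ℕ} (v : Param n) :
    ∑ i, ∑ j ∈ Finset.univ.erase i, (|v.a i| + |v.b j|) = ((n : ℝ) - 1) * ‖v‖ := by
  simp only [Finset.sum_add_distrib]
  rw [sum_erase_comm (fun _ j => |v.b j|)]
  simp only [Finset.sum_const, nsmul_eq_mul, cast_card_erase, ← Finset.mul_sum, norm_param, mul_add]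

/-- A column sum of the Jacobian at `θ` averages the factors
`ψ' (a i + b j) * (1 / ψ' (a i) + 1 / ψ' (b j))` over the edges at one vertex. -/
theorem norm_fDeriv_apply_le {n : ℕ} (hn : 2 ≤ n) {θ : Param n} (hθ : θ ∈ positiveParams n) {q : ℝ}
    (hq : ∀ i j, trigamma (θ.a i + θ.b j) * ((trigamma (θ.a i))⁻¹ + (trigamma (θ.b j))⁻¹) ≤ q)
    (v : Param n) : ‖fDeriv θ v‖ ≤ q * ‖v‖ := by
  have hm := cast_sub_one_pos hn
  set m := (n : ℝ) - 1 with hmdef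
  have key : ∀ (c : ℝ) (s : Finset (Fin n)) (w x : Fin n → ℝ), 0 < c → (∀ k, 0 < w k) →
      |c⁻¹ * (1 / m * ∑ k ∈ s, w k * x k)| ≤ 1 / m * ∑ k ∈ s, w k * c⁻¹ * |x k| := by
    intro c s w x hc hw
    rw [abs_mul, abs_mul, abs_of_pos (inv_pos.2 hc), abs_of_pos (one_div_pos.2 hm),
      mul_left_comm]
    refine mul_le_mul_of_nonneg_left ?_ (one_div_pos.2 hm).le
    refine (mul_le_mul_of_nonneg_left (Finset.abs_sum_le_sum_abs _ _) (inv_pos.2 hc).le).trans ?_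
    rw [Finset.mul_sum]
    refine Finset.sum_le_sum fun k _ => le_of_eq ?_
    rw [abs_mul, abs_of_pos (hw k)]
    ring
  have hw : ∀ i j, 0 < trigamma (θ.a i + θ.b j) := fun i j =>
    trigamma_pos (add_pos (hθ.1 i) (hθ.2 j))
  have hA : ∀ i, |(fDeriv θ v).a i| ≤ 1 / m * ∑ j ∈ Finset.univ.erase i,
      trigamma (θ.a i + θ.b j) * (trigamma (θ.a i))⁻¹ * |v.a i + v.b j| := fun i => by
    have e : (fDeriv θ v).a i = (trigamma (θ.a i))⁻¹ * (1 / m *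
        ∑ j ∈ Finset.univ.erase i, trigamma (θ.a i + θ.b j) * (v.a i + v.b j)) := by
      simp [fDeriv, Param.a, Param.b, edgeSum, hmdef, mul_add]
    rw [e]
    exact key _ _ _ _ (trigamma_pos (hθ.1 i)) fun j => hw i j
  have hB : ∀ j, |(fDeriv θ v).b j| ≤ 1 / m * ∑ i ∈ Finset.univ.erase j,
      trigamma (θ.a i + θ.b j) * (trigamma (θ.b j))⁻¹ * |v.a i + v.b j| := fun j => by
    have e : (fDeriv θ v).b j = (trigamma (θ.b j))⁻¹ * (1 / m *
        ∑ i ∈ Finset.univ.erase j, trigamma (θ.a i + θ.b j) * (v.a i + v.b j)) := by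
      simp [fDeriv, Param.a, Param.b, edgeSum, hmdef, mul_add]
    rw [e]
    exact key _ _ _ _ (trigamma_pos (hθ.2 j)) fun i => hw i j
  calc ‖fDeriv θ v‖ = ∑ i, |(fDeriv θ v).a i| + ∑ j, |(fDeriv θ v).b j| := norm_param _
    _ ≤ ∑ i, 1 / m * ∑ j ∈ Finset.univ.erase i,
            trigamma (θ.a i + θ.b j) * (trigamma (θ.a i))⁻¹ * |v.a i + v.b j|
          + ∑ j, 1 / m * ∑ i ∈ Finset.univ.erase j,
            trigamma (θ.a i + θ.b j) * (trigamma (θ.b j))⁻¹ * |v.a i + v.b j| :=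
        add_le_add (Finset.sum_le_sum fun i _ => hA i) (Finset.sum_le_sum fun j _ => hB j)
    _ = 1 / m * ∑ i, ∑ j ∈ Finset.univ.erase i, trigamma (θ.a i + θ.b j) *
          ((trigamma (θ.a i))⁻¹ + (trigamma (θ.b j))⁻¹) * |v.a i + v.b j| := by
        rw [← Finset.mul_sum, ← Finset.mul_sum, ← sum_erase_comm (fun i j =>
          trigamma (θ.a i + θ.b j) * (trigamma (θ.b j))⁻¹ * |v.a i + v.b j|), ← mul_add,
          ← Finset.sum_add_distrib]
        simp only [← Finset.sum_add_distrib, mul_add, add_mul]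
    _ ≤ 1 / m * ∑ i, ∑ j ∈ Finset.univ.erase i, q * (|v.a i| + |v.b j|) := by
        refine mul_le_mul_of_nonneg_left ?_ (one_div_pos.2 hm).le
        refine Finset.sum_le_sum fun i _ => Finset.sum_le_sum fun j _ => ?_
        refine mul_le_mul (hq i j) (abs_add_le _ _) (abs_nonneg _) (le_trans ?_ (hq i j))
        exact mul_nonneg (hw i j).le (add_nonneg (inv_nonneg.2 (trigamma_pos (hθ.1 i)).le)
          (inv_nonneg.2 (trigamma_pos (hθ.2 j)).le))
    _ = q * ‖v‖ := by
        simp only [← Finset.mul_sum]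
        rw [sum_edges_eq_norm, ← hmdef]
        field_simp

theorem norm_fDeriv_lt_one {n : ℕ} (hn : 2 ≤ n) {θ : Param n} (hθ : θ ∈ positiveParams n) :
    ‖fDeriv θ‖ < 1 := by
  let c : Fin n × Fin n → ℝ := fun p => trigamma (θ.a p.1 + θ.b p.2) *
    ((trigamma (θ.a p.1))⁻¹ + (trigamma (θ.b p.2))⁻¹)
  have : Nonempty (Fin n × Fin n) := ⟨(⟨0, by omega⟩, ⟨0, by omega⟩)⟩
  -- The norm is at most the largest of the finitely many edge factors, each of which is below `1`.
  obtain ⟨p, hp⟩ := Finite.exists_max c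
  have hp1 : c p < 1 := trigamma_add_mul_lt_one (hθ.1 p.1) (hθ.2 p.2)
  have hp0 : 0 ≤ c p := mul_nonneg (trigamma_pos (add_pos (hθ.1 p.1) (hθ.2 p.2))).le
    (add_nonneg (inv_nonneg.2 (trigamma_pos (hθ.1 p.1)).le)
      (inv_nonneg.2 (trigamma_pos (hθ.2 p.2)).le))
  exact (ContinuousLinearMap.opNorm_le_bound _ hp0
    (norm_fDeriv_apply_le hn hθ fun i j => hp (i, j))).trans_lt hp1

theorem positiveParams_mem_nhds {n : ℕ} {θ : Param n} (hθ : θ ∈ positiveParams n) :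
    positiveParams n ∈ 𝓝 θ := by
  have hcoord : ∀ k : Fin n ⊕ Fin n, 0 < θ k → ∀ᶠ η : Param n in 𝓝 θ, 0 < η k := fun k hk =>
    (PiLp.continuous_apply 1 _ k).continuousAt.eventually (lt_mem_nhds hk)
  exact (eventually_all.2 fun i => hcoord (Sum.inl i) (hθ.1 i)).and
    (eventually_all.2 fun j => hcoord (Sum.inr j) (hθ.2 j))

/-! ### Local contraction at a fixed point -/

/-- A fixed point at which the derivative has operator norm below `1` is the centre of arbitrarily
small closed balls that the map contracts into themselves. -/
theorem exists_closedBall_contraction {E : Type*} [NormedAddCommGroup E] [NormedSpace ℝ E]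
    {f : E → E} {f' : E →L[ℝ] E} {x : E} {U : Set E} (hf : HasStrictFDerivAt f f' x)
    (hf' : ‖f'‖ < 1) (hfx : f x = x) (hU : U ∈ 𝓝 x) :
    ∃ r > 0, Metric.closedBall x r ⊆ U ∧ ∃ q : ℝ≥0, q < 1 ∧
      LipschitzOnWith q f (Metric.closedBall x r) ∧
      MapsTo f (Metric.closedBall x r) (Metric.closedBall x r) := by
  obtain ⟨q, hq, hq1⟩ := exists_between (show ‖f'‖₊ < 1 from hf')
  obtain ⟨s, hs, hlip⟩ := hf.exists_lipschitzOnWith_of_nnnorm_lt q hq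
  obtain ⟨r, hr, hrs⟩ := Metric.nhds_basis_closedBall.mem_iff.1 (inter_mem hU hs)
  have hL := hlip.mono (hrs.trans inter_subset_right)
  refine ⟨r, hr, hrs.trans inter_subset_left, q, hq1, hL, fun y hy => ?_⟩
  have h := hL.dist_le_mul y hy x (Metric.mem_closedBall_self hr.le)
  rw [hfx] at h
  have hq1' : (q : ℝ) ≤ 1 := by exact_mod_cast hq1.le
  exact h.trans ((mul_le_of_le_one_left dist_nonneg hq1').trans hy)

end BetaGraph

theorem theorem2 (n : ℕ) (hn : 2 ≤ n) (W : Matrix (Fin n) (Fin n) ℝ)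
    (hW : ∀ i j, i ≠ j → W i j ∈ Set.Ioo (0 : ℝ) 1)
    (θhat : BetaGraph.Param n)
    (hθ : BetaGraph.IsMLSolution (BetaGraph.rowStat W) (BetaGraph.colStat W) θhat) :
    (∀ θ : BetaGraph.Param n,
      BetaGraph.IsMLSolution (BetaGraph.rowStat W) (BetaGraph.colStat W) θ → θ = θhat) ∧
    ∃ K : Set (BetaGraph.Param n),
      IsClosed K ∧ K ∈ 𝓝 θhat ∧ K ⊆ BetaGraph.positiveParams n ∧
      (∃ hK : Set.MapsTo (BetaGraph.fMap (BetaGraph.rowStat W) (BetaGraph.colStat W)) K K,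
        ∃ q : ℝ≥0, ContractingWith q hK.restrict) ∧
      (∀ θ ∈ K,
        BetaGraph.fMap (BetaGraph.rowStat W) (BetaGraph.colStat W) θ = θ ↔ θ = θhat) ∧
      ∀ θ₀ ∈ K,
        Tendsto (fun t : ℕ => (BetaGraph.fMap (BetaGraph.rowStat W) (BetaGraph.colStat W))^[t] θ₀)
          atTop (𝓝 θhat) := by
  have hfix := BetaGraph.fMap_eq_self hn hθ
  refine ⟨fun θ h => h.unique hn hθ, ?_⟩
  obtain ⟨r, hr, hpos, q, hq, hlip, hmaps⟩ := BetaGraph.exists_closedBall_contraction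
    (BetaGraph.hasStrictFDerivAt_fMap hn hθ) (BetaGraph.norm_fDeriv_lt_one hn hθ.1) hfix
    (BetaGraph.positiveParams_mem_nhds hθ.1)
  have hcontr : ContractingWith q hmaps.restrict :=
    ⟨hq, fun x y => hlip x.2 y.2⟩
  have hmem := Metric.mem_closedBall_self (x := θhat) hr.le
  refine ⟨Metric.closedBall θhat r, Metric.isClosed_closedBall, Metric.closedBall_mem_nhds _ hr,
    hpos, ⟨hmaps, q, hcontr⟩, fun θ hmemθ => ⟨fun hθfix => ?_, fun h => h ▸ hfix⟩, fun θ₀ h₀ => ?_⟩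
  · have hsub := hcontr.fixedPoint_unique' (x := ⟨θ, hmemθ⟩) (y := ⟨θhat, hmem⟩)
      (Subtype.ext hθfix) (Subtype.ext hfix)
    exact congrArg Subtype.val hsub
  · have : Nonempty (Metric.closedBall θhat r) := ⟨⟨θhat, hmem⟩⟩
    have : CompleteSpace (Metric.closedBall θhat r) :=
      Metric.isClosed_closedBall.completeSpace_coe
    have ht := hcontr.tendsto_iterate_fixedPoint ⟨θ₀, h₀⟩
    rw [← hcontr.fixedPoint_unique (x := ⟨θhat, hmem⟩) (Subtype.ext hfix)] at ht
    refine ((continuous_subtype_val.tendsto _).comp ht).congr fun t => ?_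
    rw [Function.comp_apply, hmaps.iterate_restrict]
    rfl
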